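/- Let $G$ be a connected (finite-dimensional, real, smooth) Lie group with identity $e$ and Lie algebra $\mathfrak g=T_eG$, and write $l_g(h)=gh$. Let $\mathfrak p\subset\mathfrak g$ be a vector subspace which generates the Lie algebra $\mathfrak g$, that is, $\mathfrak g=\mathfrak p^1+\dots+\mathfrak p^m$ for some natural number $m$, where $\mathfrak p^1=\mathfrak p$ and $\mathfrak p^{k+1}$ is the linear span of all brackets $[v,w]$ with $v\in\mathfrak p$, $w\in\mathfrak p^k$. Let $\{e_1,\dots,e_r\}$ be any basis of $\mathfrak p$. Then the left-invariant control system $$\dot g=(dl_g)(u),\qquad u\in\mathfrak p,$$ is controllable by means of piecewise constant controls whose values on the segments of constancy are of the form $\pm e_j$, $1\le j\le r$. In other words, for any $g_0,g_1\in G$ there exist $T\ge 0$ and a piecewise constant control $u=u(t)\in\mathfrak p$, $0\le t\le T$, equal on each of its segments of constancy to one of the vectors $\pm e_1,\dots,\pm e_r$, such that the solution of the Cauchy problem $$\dot g(t)=dl_{g(t)}(u(t)),\qquad g(0)=g_0$$ (a continuous curve on $[0,T]$ that satisfies the equation at all but finitely many times) satisfies $g(T)=g_1$. -/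

import Mathlib

open scoped Manifold ContDiff

/-- The space `[𝔭, 𝔮]` spanned by all brackets `[v, w]` with `v ∈ 𝔭`, `w ∈ 𝔮`. -/
def bracketSpan {L : Type*} [LieRing L] [LieAlgebra ℝ L] (p q : Submodule ℝ L) :
    Submodule ℝ L :=
  Submodule.span ℝ {x | ∃ v ∈ p, ∃ w ∈ q, x = ⁅v, w⁆}

/-- The spaces of iterated brackets; `iteratedBracket p k` is `𝔭^(k+1)`, where `𝔭^1 = 𝔭` and
`𝔭^(k+1) = [𝔭, 𝔭^k]`. -/
def iteratedBracket {L : Type*} [LieRing L] [LieAlgebra ℝ L] (p : Submodule ℝ L) :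
    ℕ → Submodule ℝ L
  | 0 => p
  | k + 1 => bracketSpan p (iteratedBracket p k)

/-- The subspace `𝔭` generates the Lie algebra: `𝔭^1 + ⋯ + 𝔭^m` is everything for some `m`. -/
def GeneratesLieAlgebra {L : Type*} [LieRing L] [LieAlgebra ℝ L] (p : Submodule ℝ L) : Prop :=
  ∃ m : ℕ, ⨆ k ∈ Finset.range m, iteratedBracket p k = ⊤

/-- A Lie group of class `C^∞` is of the class `C^3` for which the Lie algebra structure on
`GroupLieAlgebra` is available. -/
instance lieGroup_minSmoothness {E : Type*} [NormedAddCommGroup E] [NormedSpace ℝ E]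
    {H : Type*} [TopologicalSpace H] (I : ModelWithCorners ℝ E H)
    (G : Type*) [Group G] [TopologicalSpace G] [ChartedSpace H G] [LieGroup I ∞ G] :
    LieGroup I (minSmoothness ℝ 3) G :=
  LieGroup.of_le (n := ∞) (by
    rw [minSmoothness_of_isRCLikeNormedField]
    exact WithTop.coe_le_coe.mpr (le_top : (3 : ℕ∞) ≤ ⊤))

/-- `u` is piecewise constant on `[0, T]`, its value on each segment of constancy lying in `S`. -/
def IsPiecewiseConstant {V : Type*} (S : Set V) (T : ℝ) (u : ℝ → V) : Prop :=
  ∃ (N : ℕ) (τ : ℕ → ℝ), τ 0 = 0 ∧ τ N = T ∧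
    ∀ i < N, τ i < τ (i + 1) ∧ ∃ c ∈ S, ∀ t ∈ Set.Ico (τ i) (τ (i + 1)), u t = c

/-- `γ` solves the left-invariant system `γ' = dl_γ(u)` on `[0, T]` for the control `u`: it is
continuous on `[0, T]` and satisfies the equation at all but finitely many times. -/
def IsControlTrajectory {E : Type*} [NormedAddCommGroup E] [NormedSpace ℝ E]
    {H : Type*} [TopologicalSpace H] (I : ModelWithCorners ℝ E H)
    {G : Type*} [Group G] [TopologicalSpace G] [ChartedSpace H G]
    (u : ℝ → GroupLieAlgebra I G) (T : ℝ) (γ : ℝ → G) : Prop :=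
  ContinuousOn γ (Set.Icc 0 T) ∧
    ∃ F : Set ℝ, F.Finite ∧ ∀ t ∈ Set.Ioo 0 T \ F,
      HasMFDerivAt 𝓘(ℝ, ℝ) I γ t
        ((1 : ℝ →L[ℝ] ℝ).smulRight (mulInvariantVectorField (I := I) (u t) (γ t)))

/-! The elements `h` for which `g` is reachable exactly when `g * h` is form a subgroup `K`. It
contains short integral curves through the identity of the fields of `±e_j`. Once `K` is a
neighbourhood of the identity it is open, hence closed, hence all of the connected group. To see
this, read `K` in the chart at the identity as a set `S`, and let `V` consist of the vectors `v`
such that every rank one map `l ⊗ v` is the strict derivative at `0` of a map into `S`. Products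
make `V` a subspace (`IsAttainableDeriv.add`), and it contains the `e_j`. Conjugation by elements of
`K` makes `V` stable under `Ad` (`conj_mem_attainableDirections`); differentiating along the curve
of `e_j` gives `[e_j, V] ⊆ V`, so `V` is the whole Lie algebra. Then the identity map, a sum of rank
one maps, is such a derivative, and the inverse function theorem makes `S` a neighbourhood
(`mem_nhds_of_attainableDirections_eq_top`). -/

open Filter Topology

/-! ### Local groups in a normed space: adjoint action and attainable directions. -/

section LocalGroup

variable {E : Type*} [NormedAddCommGroup E] [NormedSpace ℝ E]

/-- The derivative at the identity of the adjoint action of a local group with multiplication `m`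
and conjugation `c` is the Lie bracket of left-invariant vector fields. -/
theorem fderiv_conj_eq_lieBracket {m c : E × E → E} {x₀ : E}
    (hm : ContDiffAt ℝ 2 m (x₀, x₀)) (hc : ContDiffAt ℝ 2 c (x₀, x₀))
    (hm' : fderiv ℝ m (x₀, x₀) = .fst ℝ E E + .snd ℝ E E)
    (hc' : fderiv ℝ c (x₀, x₀) = .snd ℝ E E)
    (hcx : ∀ᶠ x in 𝓝 x₀, c (x, x₀) = x₀)
    (hmc : ∀ᶠ p in 𝓝 (x₀, x₀), m (c p, p.1) = m p) (v w : E) :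
    fderiv ℝ (fun x => fderiv ℝ c (x, x₀) (0, w)) x₀ v =
      VectorField.lieBracket ℝ (fun x => fderiv ℝ m (x, x₀) (0, v))
        (fun x => fderiv ℝ m (x, x₀) (0, w)) x₀ := by
  have hl : HasFDerivAt (fun x : E => (x, x₀)) (.inl ℝ E E) x₀ := hasFDerivAt_prodMk_left x₀ x₀
  have hr : HasFDerivAt (fun x : E => (x₀, x)) (.inr ℝ E E) x₀ := hasFDerivAt_prodMk_right x₀ x₀
  have hDm : HasFDerivAt (fderiv ℝ m) (fderiv ℝ (fderiv ℝ m) (x₀, x₀)) (x₀, x₀) :=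
    ((hm.fderiv_right (m := 1) le_rfl).differentiableAt one_ne_zero).hasFDerivAt
  have hDc : HasFDerivAt (fderiv ℝ c) (fderiv ℝ (fderiv ℝ c) (x₀, x₀)) (x₀, x₀) :=
    ((hc.fderiv_right (m := 1) le_rfl).differentiableAt one_ne_zero).hasFDerivAt
  have hL : ∀ z : E, HasFDerivAt (fun x => fderiv ℝ m (x, x₀) (0, z))
      (((fderiv ℝ (fderiv ℝ m) (x₀, x₀)).comp (.inl ℝ E E)).flip (0, z)) x₀ := fun z => by
    have := (HasFDerivAt.comp x₀ (f := fun x : E => (x, x₀)) hDm hl).clm_apply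
      (hasFDerivAt_const ((0, z) : E × E) x₀)
    refine this.congr_fderiv ?_
    ext y; simp
  have hA : HasFDerivAt (fun x => fderiv ℝ c (x, x₀) (0, w))
      (((fderiv ℝ (fderiv ℝ c) (x₀, x₀)).comp (.inl ℝ E E)).flip (0, w)) x₀ := by
    have := (HasFDerivAt.comp x₀ (f := fun x : E => (x, x₀)) hDc hl).clm_apply
      (hasFDerivAt_const ((0, w) : E × E) x₀)
    refine this.congr_fderiv ?_
    ext y; simp
  have tl : Tendsto (fun x : E => (x, x₀)) (𝓝 x₀) (𝓝 (x₀, x₀)) := hl.continuousAt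
  have tr : Tendsto (fun x : E => (x₀, x)) (𝓝 x₀) (𝓝 (x₀, x₀)) := hr.continuousAt
  -- This differentiates `(x y x⁻¹) x = x y` in `y` at the identity: the right translate by `x` of
  -- `Ad x w` is the left-invariant field of `w` at `x`.
  have key : ∀ᶠ x in 𝓝 x₀, fderiv ℝ m (x₀, x) (fderiv ℝ c (x, x₀) (0, w), 0) =
      fderiv ℝ m (x, x₀) (0, w) := by
    have h1 := tl.eventually hmc.eventually_nhds
    have h2 := tl.eventually (hc.eventually (by simp))
    have h3 := tr.eventually (hm.eventually (by simp))
    filter_upwards [h1, h2, h3, hcx] with x h1 h2 h3 h4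
    have hc1 := (h2.differentiableAt (by simp)).hasFDerivAt
    have hm1 : HasFDerivAt m (fderiv ℝ m (x₀, x)) (c (x, x₀), x) := by
      rw [h4]; exact (h3.differentiableAt (by simp)).hasFDerivAt
    have hcomp : HasFDerivAt (fun p : E × E => m (c p, p.1)) _ (x, x₀) :=
      HasFDerivAt.comp (x, x₀) (f := fun p : E × E => (c p, p.1)) hm1
        (hc1.prodMk hasFDerivAt_fst)
    have := (hcomp.congr_of_eventuallyEq (h1.mono fun p hp => hp.symm)).fderiv
    rw [this]
    simp
  have hlhs := ((hDm.comp x₀ hr).clm_apply (hA.prodMk (hasFDerivAt_const (0 : E) x₀)))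
  have huniq := hlhs.unique ((hL w).congr_of_eventuallyEq key)
  have := congrArg (fun F : E →L[ℝ] E => F v) huniq
  -- Differentiating `key` along `v` gives `D²m((0,v),(w,0)) + A v = D²m((v,0),(0,w))`, with `A` the
  -- derivative of `x ↦ Ad x w`; by symmetry of `D²m`, `A v` is the bracket.
  have hsymm := hm.isSymmSndFDerivAt (by simp) (0, v) (w, 0)
  simp [hm', hc'] at this
  rw [VectorField.lieBracket, (hL v).fderiv, (hL w).fderiv, hA.fderiv]
  simp [hm']
  rw [← this, hsymm]
  abel

/-- `A` is the strict derivative at `0` of a map which sends `0` to `x₀` and a neighbourhood of `0`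
into `S`. -/
def IsAttainableDeriv (S : Set E) (x₀ : E) (A : E →L[ℝ] E) : Prop :=
  ∃ f : E → E, HasStrictFDerivAt f A 0 ∧ f 0 = x₀ ∧ ∀ᶠ x in 𝓝 0, f x ∈ S

theorem IsAttainableDeriv.zero {S : Set E} {x₀ : E} (h : x₀ ∈ S) :
    IsAttainableDeriv S x₀ 0 :=
  ⟨fun _ => x₀, hasStrictFDerivAt_const _ _, rfl, .of_forall fun _ => h⟩

/-- The pointwise product of two maps has the sum of their derivatives, as `m` has derivative `fst +
snd` at the identity. -/
theorem IsAttainableDeriv.add {S : Set E} {x₀ : E} {m : E × E → E}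
    (hm : HasStrictFDerivAt m (.fst ℝ E E + .snd ℝ E E) (x₀, x₀)) (hm0 : m (x₀, x₀) = x₀)
    (hS : ∀ᶠ p in 𝓝 (x₀, x₀), p.1 ∈ S → p.2 ∈ S → m p ∈ S) {A B : E →L[ℝ] E}
    (hA : IsAttainableDeriv S x₀ A) (hB : IsAttainableDeriv S x₀ B) :
    IsAttainableDeriv S x₀ (A + B) := by
  obtain ⟨f, hf, hf0, hfS⟩ := hA
  obtain ⟨g, hg, hg0, hgS⟩ := hB
  refine ⟨fun x => m (f x, g x), ?_, by simp only [hf0, hg0, hm0], ?_⟩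
  · have : HasStrictFDerivAt m (.fst ℝ E E + .snd ℝ E E) (f 0, g 0) := by rwa [hf0, hg0]
    refine (this.comp (0 : E) (hf.prodMk hg)).congr_fderiv ?_
    ext y; simp
  · have ht : Tendsto (fun x => (f x, g x)) (𝓝 0) (𝓝 (x₀, x₀)) := by
      have := (hf.prodMk hg).continuousAt
      rwa [ContinuousAt, hf0, hg0] at this
    filter_upwards [ht.eventually hS, hfS, hgS] with x h1 h2 h3 using h1 h2 h3

theorem IsAttainableDeriv.comp_left {S : Set E} {x₀ : E} {h : E → E} {B : E →L[ℝ] E}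
    (hh : HasStrictFDerivAt h B x₀) (hh0 : h x₀ = x₀)
    (hS : ∀ᶠ y in 𝓝 x₀, y ∈ S → h y ∈ S) {A : E →L[ℝ] E}
    (hA : IsAttainableDeriv S x₀ A) : IsAttainableDeriv S x₀ (B.comp A) := by
  obtain ⟨f, hf, hf0, hfS⟩ := hA
  refine ⟨fun x => h (f x), ?_, by simp only [hf0, hh0], ?_⟩
  · rw [← hf0] at hh
    exact hh.comp (0 : E) hf
  · have ht : Tendsto f (𝓝 0) (𝓝 x₀) := by
      have := hf.continuousAt
      rwa [ContinuousAt, hf0] at this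
    filter_upwards [ht.eventually hS, hfS] with x h1 h2 using h1 h2

/-- The vectors `v` such that every rank one map with image spanned by `v` is attainable. -/
def attainableDirections (S : Set E) (x₀ : E) (m : E × E → E)
    (hm : HasStrictFDerivAt m (.fst ℝ E E + .snd ℝ E E) (x₀, x₀)) (hm0 : m (x₀, x₀) = x₀)
    (hmS : ∀ᶠ p in 𝓝 (x₀, x₀), p.1 ∈ S → p.2 ∈ S → m p ∈ S) (hS : x₀ ∈ S) :
    Submodule ℝ E where
  carrier := {v | ∀ l : E →L[ℝ] ℝ, IsAttainableDeriv S x₀ (l.smulRight v)}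
  zero_mem' l := by
    have : l.smulRight (0 : E) = 0 := by ext; simp
    rw [this]; exact .zero hS
  add_mem' {v w} hv hw l := by
    have : l.smulRight (v + w) = l.smulRight v + l.smulRight w := by ext; simp
    rw [this]; exact (hv l).add hm hm0 hmS (hw l)
  smul_mem' a v hv l := by
    -- Quantifying over all `l` lets the scalar be absorbed into the functional.
    have : l.smulRight (a • v) = (a • l).smulRight v := by ext; simp [smul_smul, mul_comm]
    rw [this]; exact hv _

section Directions

variable {S : Set E} {x₀ : E} {m c : E × E → E}
    {hm : HasStrictFDerivAt m (.fst ℝ E E + .snd ℝ E E) (x₀, x₀)} {hm0 : m (x₀, x₀) = x₀}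
    {hmS : ∀ᶠ p in 𝓝 (x₀, x₀), p.1 ∈ S → p.2 ∈ S → m p ∈ S} {hS : x₀ ∈ S}

theorem mem_attainableDirections_of_curve {v : E} {x : ℝ → E} (hx : HasStrictDerivAt x v 0)
    (hx0 : x 0 = x₀) (hxS : ∀ᶠ t in 𝓝 0, x t ∈ S) :
    v ∈ attainableDirections S x₀ m hm hm0 hmS hS := by
  intro l
  have hl : HasStrictFDerivAt l l (0 : E) := l.hasStrictFDerivAt
  have hx' : HasStrictFDerivAt x ((1 : ℝ →L[ℝ] ℝ).smulRight v) (l 0) := by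
    rw [map_zero]; exact hx.hasStrictFDerivAt
  refine ⟨fun y => x (l y), ?_, by simp [hx0], ?_⟩
  · refine (hx'.comp (0 : E) hl).congr_fderiv ?_
    ext y; simp
  · have : Tendsto l (𝓝 0) (𝓝 0) := by simpa using l.continuous.tendsto 0
    exact this.eventually hxS

/-- For `x ∈ S`, the map `y ↦ c (x, y)` fixes `x₀` and locally preserves `S`, so composing with it
applies `Ad x` to attainable derivatives. -/
theorem conj_mem_attainableDirections (hc : ContDiffAt ℝ 2 c (x₀, x₀))
    (hcx : ∀ᶠ x in 𝓝 x₀, c (x, x₀) = x₀)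
    (hcS : ∀ᶠ p in 𝓝 (x₀, x₀), p.1 ∈ S → p.2 ∈ S → c p ∈ S) :
    ∀ᶠ x in 𝓝 x₀, x ∈ S → ∀ w ∈ attainableDirections S x₀ m hm hm0 hmS hS,
      fderiv ℝ c (x, x₀) (0, w) ∈ attainableDirections S x₀ m hm hm0 hmS hS := by
  have tl : Tendsto (fun x : E => (x, x₀)) (𝓝 x₀) (𝓝 (x₀, x₀)) :=
    (hasFDerivAt_prodMk_left (𝕜 := ℝ) x₀ x₀).continuousAt
  filter_upwards [tl.eventually (hc.eventually (by simp)), hcx, tl.eventually hcS.eventually_nhds]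
    with x h1 h2 h3 hx w hw l
  have hr : HasStrictFDerivAt (fun y : E => (x, y)) (.inr ℝ E E) x₀ :=
    (hasStrictFDerivAt_const x x₀).prodMk (hasStrictFDerivAt_id x₀)
  have := (h1.hasStrictFDerivAt (by simp)).comp x₀ hr
  have hev := (hr.continuousAt (x := x₀)).tendsto.eventually h3
  have := (hw l).comp_left this h2 (hev.mono fun y hy hyS => hy hx hyS)
  convert this using 1
  ext y; simp

/-- The curve `Ad (x t) w` stays in a subspace that is closed by finite dimension, so the limit of
its difference quotients lies there too. -/
theorem fderiv_conj_mem_attainableDirections [FiniteDimensional ℝ E]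
    (hc : ContDiffAt ℝ 2 c (x₀, x₀))
    (hcx : ∀ᶠ x in 𝓝 x₀, c (x, x₀) = x₀)
    (hcS : ∀ᶠ p in 𝓝 (x₀, x₀), p.1 ∈ S → p.2 ∈ S → c p ∈ S)
    {v : E} {x : ℝ → E} (hx : HasDerivAt x v 0)
    (hx0 : x 0 = x₀) (hxS : ∀ᶠ t in 𝓝 0, x t ∈ S)
    {w : E} (hw : w ∈ attainableDirections S x₀ m hm hm0 hmS hS) :
    fderiv ℝ (fun x => fderiv ℝ c (x, x₀) (0, w)) x₀ v ∈
      attainableDirections S x₀ m hm hm0 hmS hS := by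
  set V := attainableDirections S x₀ m hm hm0 hmS hS
  have hA : DifferentiableAt ℝ (fun x => fderiv ℝ c (x, x₀) (0, w)) (x 0) := by
    rw [hx0]
    have h1 := (hc.fderiv_right (m := 1) le_rfl).differentiableAt one_ne_zero
    have h2 := DifferentiableAt.comp x₀ (f := fun x : E => (x, x₀)) h1
      (hasFDerivAt_prodMk_left (𝕜 := ℝ) x₀ x₀).differentiableAt
    exact h2.clm_apply (differentiableAt_const _)
  have hd := hA.hasFDerivAt.comp_hasDerivAt (0 : ℝ) hx
  rw [hx0] at hd
  have tx : Tendsto x (𝓝 0) (𝓝 x₀) := hx0 ▸ hx.continuousAt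
  have hev := tx.eventually (conj_mem_attainableDirections (hm := hm) (hm0 := hm0) (hmS := hmS)
    (hS := hS) hc hcx hcS)
  have hmem : ∀ᶠ t in 𝓝 (0 : ℝ), fderiv ℝ c (x t, x₀) (0, w) ∈ V := by
    filter_upwards [hev, hxS] with t h1 h2 using h1 h2 w hw
  refine V.closed_of_finiteDimensional.mem_of_tendsto hd.tendsto_slope
    ((hmem.filter_mono nhdsWithin_le_nhds).mono fun t ht => ?_)
  exact V.smul_mem _ (V.sub_mem ht hmem.self_of_nhds)

/-- The identity is the sum of the rank one maps `b.coord i ⊗ b i`; a map into `S` with this strict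
derivative is locally onto. -/
theorem mem_nhds_of_attainableDirections_eq_top [FiniteDimensional ℝ E]
    (h : attainableDirections S x₀ m hm hm0 hmS hS = ⊤) : S ∈ 𝓝 x₀ := by
  have hid : IsAttainableDeriv S x₀ (.id ℝ E) := by
    let b := Module.finBasis ℝ E
    have hsum : ∀ s : Finset (Fin (Module.finrank ℝ E)), IsAttainableDeriv S x₀
        (∑ i ∈ s, (b.coord i).toContinuousLinearMap.smulRight (b i)) := fun s => by
      classical
      induction s using Finset.induction_on with
      | empty => simp [IsAttainableDeriv.zero hS]
      | insert i s hi ih =>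
        rw [Finset.sum_insert hi]
        have : b i ∈ attainableDirections S x₀ m hm hm0 hmS hS := h ▸ Submodule.mem_top
        exact (this _).add hm hm0 hmS ih
    convert hsum Finset.univ
    ext y
    simp [b.sum_repr y]
  obtain ⟨f, hf, hf0, hfS⟩ := hid
  have := HasStrictFDerivAt.map_nhds_eq_of_equiv (f' := ContinuousLinearEquiv.refl ℝ E) hf
  rw [hf0] at this
  rw [← this]
  exact hfS

end Directions

end LocalGroup

/-! ### The Lie group in the chart at the identity. -/

section Chart

variable {E : Type*} [NormedAddCommGroup E] [NormedSpace ℝ E]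
  {H : Type*} [TopologicalSpace H] (I : ModelWithCorners ℝ E H)
  (G : Type*) [Group G] [TopologicalSpace G] [ChartedSpace H G]

/-- The multiplication of `G` read in the chart at the identity. -/
noncomputable def chartMul (p : E × E) : E :=
  extChartAt I (1 : G) ((extChartAt I (1 : G)).symm p.1 * (extChartAt I (1 : G)).symm p.2)

/-- Conjugation in `G` read in the chart at the identity. -/
noncomputable def chartConj (p : E × E) : E :=
  extChartAt I (1 : G) ((extChartAt I (1 : G)).symm p.1 * (extChartAt I (1 : G)).symm p.2 *
    ((extChartAt I (1 : G)).symm p.1)⁻¹)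

variable {I G}

local notation "φ" => extChartAt I (1 : G)

theorem chart_symm_one : (φ).symm (φ 1) = 1 := extChartAt_to_inv 1

theorem tendsto_chart_symm : Tendsto (φ).symm (𝓝 (φ 1)) (𝓝 1) := by
  have := continuousAt_extChartAt_symm (I := I) (1 : G)
  rwa [ContinuousAt, chart_symm_one] at this

theorem chartMul_self : chartMul I G (φ 1, φ 1) = φ 1 := by
  simp only [chartMul, chart_symm_one, mul_one]

theorem chartConj_left (x : E) : chartConj I G (x, φ 1) = φ 1 := by
  simp only [chartConj, chart_symm_one, mul_one, mul_inv_cancel]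

theorem eventually_chartMul_left [I.Boundaryless] :
    ∀ᶠ x in 𝓝 (φ 1), chartMul I G (x, φ 1) = x := by
  filter_upwards [extChartAt_target_mem_nhds (I := I) (1 : G)] with x hx
  simp only [chartMul, chart_symm_one, mul_one, (φ).right_inv hx]

theorem eventually_chartMul_right [I.Boundaryless] :
    ∀ᶠ x in 𝓝 (φ 1), chartMul I G (φ 1, x) = x := by
  filter_upwards [extChartAt_target_mem_nhds (I := I) (1 : G)] with x hx
  simp only [chartMul, chart_symm_one, one_mul, (φ).right_inv hx]

theorem eventually_chartConj_right [I.Boundaryless] :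
    ∀ᶠ x in 𝓝 (φ 1), chartConj I G (φ 1, x) = x := by
  filter_upwards [extChartAt_target_mem_nhds (I := I) (1 : G)] with x hx
  simp only [chartConj, chart_symm_one, one_mul, inv_one, mul_one, (φ).right_inv hx]

variable [LieGroup I ∞ G]

theorem tendsto_chart_symm_mul :
    Tendsto (fun p : E × E => (φ).symm p.1 * (φ).symm p.2) (𝓝 (φ 1, φ 1)) (𝓝 1) := by
  have := topologicalGroup_of_lieGroup I ∞ (G := G)
  have h := tendsto_chart_symm (I := I) (G := G)
  rw [nhds_prod_eq]
  simpa using (h.comp tendsto_fst).mul (h.comp tendsto_snd)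

theorem tendsto_chart_symm_conj :
    Tendsto (fun p : E × E => (φ).symm p.1 * (φ).symm p.2 * ((φ).symm p.1)⁻¹)
      (𝓝 (φ 1, φ 1)) (𝓝 1) := by
  have := topologicalGroup_of_lieGroup I ∞ (G := G)
  have h := tendsto_chart_symm (I := I) (G := G)
  rw [nhds_prod_eq]
  simpa using ((h.comp tendsto_fst).mul (h.comp tendsto_snd)).mul (h.comp tendsto_fst).inv

theorem eventually_chart_symm_chartMul : ∀ᶠ p in 𝓝 (φ 1, φ 1),
    (φ).symm (chartMul I G p) = (φ).symm p.1 * (φ).symm p.2 := by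
  filter_upwards [tendsto_chart_symm_mul (extChartAt_source_mem_nhds (I := I) (1 : G))] with p hp
  exact (φ).left_inv hp

theorem eventually_chart_symm_chartConj : ∀ᶠ p in 𝓝 (φ 1, φ 1),
    (φ).symm (chartConj I G p) = (φ).symm p.1 * (φ).symm p.2 * ((φ).symm p.1)⁻¹ := by
  filter_upwards [tendsto_chart_symm_conj (extChartAt_source_mem_nhds (I := I) (1 : G))] with p hp
  exact (φ).left_inv hp

theorem eventually_chartMul_chartConj : ∀ᶠ p in 𝓝 (φ 1, φ 1),
    chartMul I G (chartConj I G p, p.1) = chartMul I G p := by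
  filter_upwards [eventually_chart_symm_chartConj] with p hp
  simp only [chartMul, hp, inv_mul_cancel_right]

variable [I.Boundaryless]

theorem contMDiffAt_chart_symm : ContMDiffAt 𝓘(ℝ, E) I ∞ (φ).symm (φ 1) :=
  have := LieGroup.toContMDiffMul (I := I) (n := ∞) (G := G)
  (contMDiffOn_extChartAt_symm (1 : G)).contMDiffAt (extChartAt_target_mem_nhds (1 : G))

theorem contDiffAt_chartMul : ContDiffAt ℝ ∞ (chartMul I G) (φ 1, φ 1) := by
  rw [← contMDiffAt_iff_contDiffAt]
  have h := contMDiffAt_chart_symm (I := I) (G := G)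
  have h1 : ContMDiffAt 𝓘(ℝ, E × E) I ∞ (fun p : E × E => (φ).symm p.1)
    (φ 1, φ 1) := ContMDiffAt.comp (φ 1, φ 1) h contDiffAt_fst.contMDiffAt
  have h2 : ContMDiffAt 𝓘(ℝ, E × E) I ∞ (fun p : E × E => (φ).symm p.2)
    (φ 1, φ 1) := ContMDiffAt.comp (φ 1, φ 1) h contDiffAt_snd.contMDiffAt
  have h3 := h1.mul h2
  refine ContMDiffAt.comp (φ 1, φ 1) (g := φ) ?_ h3
  simp only [chart_symm_one, mul_one]
  exact contMDiffAt_extChartAt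

theorem contDiffAt_chartConj : ContDiffAt ℝ ∞ (chartConj I G) (φ 1, φ 1) := by
  rw [← contMDiffAt_iff_contDiffAt]
  have h := contMDiffAt_chart_symm (I := I) (G := G)
  have h1 : ContMDiffAt 𝓘(ℝ, E × E) I ∞ (fun p : E × E => (φ).symm p.1)
    (φ 1, φ 1) := ContMDiffAt.comp (φ 1, φ 1) h contDiffAt_fst.contMDiffAt
  have h2 : ContMDiffAt 𝓘(ℝ, E × E) I ∞ (fun p : E × E => (φ).symm p.2)
    (φ 1, φ 1) := ContMDiffAt.comp (φ 1, φ 1) h contDiffAt_snd.contMDiffAt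
  have h3 := (h1.mul h2).mul h1.inv
  refine ContMDiffAt.comp (φ 1, φ 1) (g := φ) ?_ h3
  simp only [chart_symm_one, mul_one, inv_one]
  exact contMDiffAt_extChartAt

theorem hasStrictFDerivAt_chartMul :
    HasStrictFDerivAt (chartMul I G) (.fst ℝ E E + .snd ℝ E E) (φ 1, φ 1) := by
  have h := (contDiffAt_chartMul (I := I) (G := G)).hasStrictFDerivAt (by simp)
  have hl : HasFDerivAt (fun x => chartMul I G (x, φ 1)) _ (φ 1) :=
    HasFDerivAt.comp (φ 1) (g := chartMul I G) (f := fun x => (x, φ 1)) h.hasFDerivAt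
      (hasFDerivAt_prodMk_left (φ 1) (φ 1))
  have hr : HasFDerivAt (fun x => chartMul I G (φ 1, x)) _ (φ 1) :=
    HasFDerivAt.comp (φ 1) (g := chartMul I G) (f := fun x => (φ 1, x)) h.hasFDerivAt
      (hasFDerivAt_prodMk_right (φ 1) (φ 1))
  have hl' := hl.unique ((hasFDerivAt_id (φ 1)).congr_of_eventuallyEq eventually_chartMul_left)
  have hr' := hr.unique ((hasFDerivAt_id (φ 1)).congr_of_eventuallyEq eventually_chartMul_right)
  refine h.congr_fderiv ?_
  refine ContinuousLinearMap.prod_ext ?_ ?_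
  · rw [hl']; ext; simp
  · rw [hr']; ext; simp

theorem fderiv_chartConj :
    fderiv ℝ (chartConj I G) (φ 1, φ 1) = .snd ℝ E E := by
  have h := ((contDiffAt_chartConj (I := I) (G := G)).differentiableAt (by simp)).hasFDerivAt
  have hl : HasFDerivAt (fun x => chartConj I G (x, φ 1)) _ (φ 1) :=
    HasFDerivAt.comp (φ 1) (g := chartConj I G) (f := fun x => (x, φ 1)) h
      (hasFDerivAt_prodMk_left (φ 1) (φ 1))
  have hr : HasFDerivAt (fun x => chartConj I G (φ 1, x)) _ (φ 1) :=
    HasFDerivAt.comp (φ 1) (g := chartConj I G) (f := fun x => (φ 1, x)) h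
      (hasFDerivAt_prodMk_right (φ 1) (φ 1))
  have hl' := hl.unique ((hasFDerivAt_const (φ 1) (φ 1)).congr_of_eventuallyEq
    (.of_forall chartConj_left))
  have hr' := hr.unique ((hasFDerivAt_id (φ 1)).congr_of_eventuallyEq eventually_chartConj_right)
  refine ContinuousLinearMap.prod_ext ?_ ?_
  · rw [hl']; ext; simp
  · rw [hr']; ext; simp

/-- The left-invariant vector field of `v` in the chart at the identity. -/
theorem eventually_mfderiv_chart_symm_eq (v : GroupLieAlgebra I G) : ∀ᶠ x in 𝓝 (φ 1),
    mfderiv 𝓘(ℝ, E) I (φ).symm x (fderiv ℝ (chartMul I G) (x, φ 1) (0, v)) =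
      mulInvariantVectorField v ((φ).symm x) := by
  have := LieGroup.toContMDiffMul (I := I) (n := ∞) (G := G)
  have tl : Tendsto (fun x : E => (x, φ 1)) (𝓝 (φ 1)) (𝓝 (φ 1, φ 1)) :=
    (hasFDerivAt_prodMk_left (𝕜 := ℝ) (φ 1) (φ 1)).continuousAt
  have hm := (contDiffAt_chartMul (I := I) (G := G)).of_le (m := 1) (by simp)
  filter_upwards [extChartAt_target_mem_nhds (I := I) (1 : G), eventually_chartMul_left,
    tl.eventually (hm.eventually (by simp)),
    tl.eventually eventually_chart_symm_chartMul.eventually_nhds]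
    with x hx hx' hmx hmul
  have hs : ContMDiffAt 𝓘(ℝ, E) I ∞ (φ).symm x :=
    (contMDiffOn_extChartAt_symm (1 : G)).contMDiffAt
      ((isOpen_extChartAt_target (1 : G)).mem_nhds hx)
  -- The tangent space at `1` is identified with `E` through this very chart, whose derivative there
  -- is thus the identity.
  have h1 : HasMFDerivAt I 𝓘(ℝ, E) φ (1 : G) (ContinuousLinearMap.id ℝ _) := by
    rw [← mfderiv_extChartAt_self]
    exact (mdifferentiableAt_extChartAt (mem_chart_source H (1 : G))).hasMFDerivAt
  have h2 : HasFDerivAt (fun y => chartMul I G (x, y)) _ (φ 1) :=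
    HasFDerivAt.comp (φ 1) (g := chartMul I G) (f := fun y => (x, y)) (hmx.differentiableAt (by simp)).hasFDerivAt
      (hasFDerivAt_prodMk_right x (φ 1))
  have h3 : HasMFDerivAt 𝓘(ℝ, E) I (φ).symm (chartMul I G (x, φ 1))
      (mfderiv 𝓘(ℝ, E) I (φ).symm x) := by
    rw [hx']
    exact (hs.mdifferentiableAt (by simp)).hasMFDerivAt
  have h4 := (h3.comp (φ 1) h2.hasMFDerivAt).comp (1 : G) h1
  have hev : (fun g : G => (φ).symm x * g) =ᶠ[𝓝 1]
      (((φ).symm ∘ fun y => chartMul I G (x, y)) ∘ φ) := by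
    have ht : Tendsto (fun g => (x, φ g)) (𝓝 1) (𝓝 (x, φ 1)) :=
      tendsto_const_nhds.prodMk_nhds (continuousAt_extChartAt (1 : G))
    filter_upwards [ht.eventually hmul, extChartAt_source_mem_nhds (I := I) (1 : G)] with g hg hg'
    simp only [Function.comp_apply, hg, (φ).left_inv hg']
  have h5 := (h4.congr_of_eventuallyEq hev).mfderiv
  rw [mulInvariantVectorField, h5]
  rfl

theorem contDiffAt_fderiv_chartMul (v : E) :
    ContDiffAt ℝ 1 (fun x => fderiv ℝ (chartMul I G) (x, φ 1) (0, v)) (φ 1) := by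
  have h := (contDiffAt_chartMul (I := I) (G := G)).fderiv_right (m := 1) (by norm_cast)
  have hl : ContDiffAt ℝ 1 (fun x : E => (x, φ 1)) (φ 1) :=
    contDiffAt_id.prodMk contDiffAt_const
  exact (ContDiffAt.comp (φ 1) (f := fun x : E => (x, φ 1)) h hl).clm_apply contDiffAt_const

/-- The bracket is that of left-invariant fields at `1`, computed by pulling them back along the
inverse chart; near `φ 1` the pullbacks are the fields on the right. -/
theorem groupLieAlgebra_bracket_eq_lieBracket (v w : GroupLieAlgebra I G) :
    ⁅v, w⁆ = VectorField.lieBracket ℝ (fun x => fderiv ℝ (chartMul I G) (x, φ 1) (0, v))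
      (fun x => fderiv ℝ (chartMul I G) (x, φ 1) (0, w)) (φ 1) := by
  have : IsManifold I 1 G := IsManifold.of_le (n := ∞) (by simp)
  have key : ∀ v : GroupLieAlgebra I G,
      VectorField.mpullbackWithin 𝓘(ℝ, E) I (φ).symm (mulInvariantVectorField v) (Set.range I)
        =ᶠ[𝓝 (φ 1)] fun x => fderiv ℝ (chartMul I G) (x, φ 1) (0, v) := fun v => by
    filter_upwards [eventually_mfderiv_chart_symm_eq v,
      extChartAt_target_mem_nhds (I := I) (1 : G)] with x hx hx'
    have hinv := isInvertible_mfderivWithin_extChartAt_symm hx'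
    rw [VectorField.mpullbackWithin_apply, ← hx]
    rw [I.range_eq_univ, mfderivWithin_univ] at hinv ⊢
    exact hinv.inverse_apply_eq.2 rfl
  have hid : ∀ A : E →L[ℝ] E, A = .id ℝ E → ∀ X, A.inverse X = X := by
    rintro _ rfl X
    rw [ContinuousLinearMap.inverse_id]
    rfl
  rw [GroupLieAlgebra.bracket_def, VectorField.mlieBracket, VectorField.mlieBracketWithin_apply]
  refine (hid _ mfderiv_extChartAt_self _).trans ?_
  have hcongr : ∀ (A A' B B' : E → E) (s : Set E), s = Set.univ → A =ᶠ[𝓝 (φ 1)] A' →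
      B =ᶠ[𝓝 (φ 1)] B' → VectorField.lieBracketWithin ℝ A B s (φ 1) =
        VectorField.lieBracket ℝ A' B' (φ 1) := by
    rintro A A' B B' _ rfl hA hB
    rw [VectorField.lieBracketWithin_univ]
    exact hA.lieBracket_vectorField_eq hB
  exact hcongr _ _ _ _ _ (by rw [Set.preimage_univ, Set.univ_inter, I.range_eq_univ])
    (key v) (key w)

/-- Picard–Lindelöf in the chart. A short curve suffices, so no exponential map is needed; the
derivative is strict because the velocity is continuous. -/
theorem exists_integralCurve_mulInvariantVectorField [CompleteSpace E]
    (v : GroupLieAlgebra I G) :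
    ∃ x : ℝ → E, x 0 = φ 1 ∧ HasStrictDerivAt x (v : E) 0 ∧
      ∀ᶠ t in 𝓝 0, HasMFDerivAt 𝓘(ℝ, ℝ) I (fun t => (φ).symm (x t)) t
        ((1 : ℝ →L[ℝ] ℝ).smulRight (mulInvariantVectorField v ((φ).symm (x t)))) := by
  have := LieGroup.toContMDiffMul (I := I) (n := ∞) (G := G)
  have hL := contDiffAt_fderiv_chartMul (I := I) (G := G) v
  obtain ⟨x, hx0, ε, hε, hx⟩ :=
    hL.exists_forall_mem_closedBall_exists_eq_forall_mem_Ioo_hasDerivAt₀ 0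
  have hx : ∀ᶠ t in 𝓝 (0 : ℝ), HasDerivAt x (fderiv ℝ (chartMul I G) (x t, φ 1) (0, v)) t := by
    filter_upwards [Ioo_mem_nhds (a := 0 - ε) (b := 0 + ε) (by linarith) (by linarith)] with t ht
    exact hx t ht
  have tx : Tendsto x (𝓝 0) (𝓝 (φ 1)) := hx0 ▸ hx.self_of_nhds.continuousAt
  refine ⟨x, hx0, ?_, ?_⟩
  · have h := hasStrictDerivAt_of_hasDerivAt_of_continuousAt hx ?_
    · rw [hx0, hasStrictFDerivAt_chartMul.hasFDerivAt.fderiv] at h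
      exact h.congr_deriv (zero_add (v : E))
    · have h := hL.continuousAt.tendsto.comp tx
      rw [← hx0] at h
      rw [ContinuousAt, ← hx0]
      exact h
  · filter_upwards [hx, tx.eventually (eventually_mfderiv_chart_symm_eq v),
      tx (extChartAt_target_mem_nhds (I := I) (1 : G))] with t h1 h2 h3
    have hs : ContMDiffAt 𝓘(ℝ, E) I ∞ (φ).symm (x t) :=
      (contMDiffOn_extChartAt_symm (1 : G)).contMDiffAt
        ((isOpen_extChartAt_target (1 : G)).mem_nhds h3)
    have h4 := (hs.mdifferentiableAt (by simp)).hasMFDerivAt.comp t h1.hasFDerivAt.hasMFDerivAt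
    refine h4.congr_mfderiv ?_
    rw [← h2]
    have key : ∀ (A : E →L[ℝ] E) (X : E), A.comp (.toSpanSingleton ℝ X) =
        (1 : ℝ →L[ℝ] ℝ).smulRight (A X) := fun A X => by ext; simp
    exact key _ _

end Chart

/-! ### Concatenation of trajectories and the reachable subgroup. -/

section Reachability

variable {E : Type*} [NormedAddCommGroup E] [NormedSpace ℝ E]
  {H : Type*} [TopologicalSpace H] {I : ModelWithCorners ℝ E H}
  {G : Type*} [Group G] [TopologicalSpace G] [ChartedSpace H G]

/-- `g₁` is reachable from `g₀` by means of piecewise constant controls with values in `D`. -/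
def IsReachable {p : Submodule ℝ (GroupLieAlgebra I G)} (D : Set p) (g₀ g₁ : G) : Prop :=
  ∃ T : ℝ, 0 ≤ T ∧ ∃ u : ℝ → p, IsPiecewiseConstant D T u ∧
    ∃ γ : ℝ → G, IsControlTrajectory I (fun t => (u t : GroupLieAlgebra I G)) T γ ∧
      γ 0 = g₀ ∧ γ T = g₁

/-- `η` is an integral curve of the left-invariant vector field of `v` at the time `t`. -/
def IsInvariantCurveAt (v : GroupLieAlgebra I G) (η : ℝ → G) (t : ℝ) : Prop :=
  HasMFDerivAt 𝓘(ℝ, ℝ) I η t ((1 : ℝ →L[ℝ] ℝ).smulRight (mulInvariantVectorField v (η t)))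

theorem IsInvariantCurveAt.comp_hasDerivAt {v : GroupLieAlgebra I G} {η : ℝ → G} {f : ℝ → ℝ} {t a : ℝ}
    (h : IsInvariantCurveAt v η (f t)) (hf : HasDerivAt f a t) :
    IsInvariantCurveAt (a • v) (fun s => η (f s)) t := by
  refine (HasMFDerivAt.comp t h hf.hasFDerivAt.hasMFDerivAt).congr_mfderiv ?_
  rw [mulInvariantVectorField_smul]
  have key : ∀ X : E, ((1 : ℝ →L[ℝ] ℝ).smulRight X).comp (.toSpanSingleton ℝ a) =
      (1 : ℝ →L[ℝ] ℝ).smulRight (a • X) := fun X => by ext; simp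
  exact key _

theorem IsInvariantCurveAt.congr_of_eventuallyEq {v : GroupLieAlgebra I G} {η η' : ℝ → G} {t : ℝ}
    (h : IsInvariantCurveAt v η t) (he : η' =ᶠ[𝓝 t] η) : IsInvariantCurveAt v η' t := by
  refine (HasMFDerivAt.congr_of_eventuallyEq h he).congr_mfderiv ?_
  have key : ∀ g : G, g = η t → (1 : ℝ →L[ℝ] ℝ).smulRight (M₂ := E)
      (mulInvariantVectorField v (η t)) = (1 : ℝ →L[ℝ] ℝ).smulRight (M₂ := E)
      (mulInvariantVectorField v g) := by
    rintro _ rfl; rfl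
  exact key _ he.self_of_nhds

theorem IsInvariantCurveAt.mul_left [LieGroup I ∞ G] {v : GroupLieAlgebra I G} {η : ℝ → G} {t : ℝ}
    (h : IsInvariantCurveAt v η t) (g : G) : IsInvariantCurveAt v (fun s => g * η s) t := by
  have := LieGroup.toContMDiffMul (I := I) (n := ∞) (G := G)
  have hmul : ∀ g h : G, MDifferentiableAt I I (g * ·) h := fun g h =>
    (contMDiff_mul_left (n := ∞)).contMDiffAt.mdifferentiableAt (by simp)
  refine ((hmul g (η t)).hasMFDerivAt.comp t h).congr_mfderiv ?_
  have h1 : HasMFDerivAt I I (η t * ·) (1 : G) (mfderiv I I (η t * ·) (1 : G)) :=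
    (hmul _ _).hasMFDerivAt
  have h2 : HasMFDerivAt I I (g * ·) (η t * 1) (mfderiv I I (g * ·) (η t)) := by
    rw [mul_one]; exact (hmul _ _).hasMFDerivAt
  have h3 := (h2.comp (1 : G) h1).mfderiv
  have h4 : (g * ·) ∘ (η t * ·) = (g * η t * ·) := by ext; simp [mul_assoc]
  rw [h4] at h3
  have key : ∀ (A : E →L[ℝ] E) (X : E), A.comp ((1 : ℝ →L[ℝ] ℝ).smulRight X) =
      (1 : ℝ →L[ℝ] ℝ).smulRight (A X) := fun A X => by ext; simp
  rw [mulInvariantVectorField, mulInvariantVectorField, h3]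
  exact key _ _

theorem IsReachable.append {p : Submodule ℝ (GroupLieAlgebra I G)} {D : Set p} {g₀ : G} {v : p}
    (hv : v ∈ D) {s : ℝ} (hs : 0 < s) {η : ℝ → G}
    (hη : ∀ t ∈ Set.Icc 0 s, IsInvariantCurveAt (v : GroupLieAlgebra I G) η t)
    (h : IsReachable D g₀ (η 0)) : IsReachable D g₀ (η s) := by
  obtain ⟨T, hT, u, ⟨N, τ, hτ0, hτN, hτ⟩, γ, ⟨hγc, F, hF, hγ⟩, hγ0, hγT⟩ := h
  have hmono : ∀ k ≤ N, τ k ≤ T := fun k hk => by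
    rw [← hτN]
    induction hk using Nat.decreasingInduction with
    | self => exact le_rfl
    | of_succ k hk ih => exact (hτ k hk).1.le.trans ih
  -- Segments are half-open, so the control switches at `T` itself; the curve may take either branch
  -- there since `γ T = η 0`, and `T` joins the exceptional times.
  refine ⟨T + s, by positivity, fun t => if t < T then u t else v,
    ⟨N + 1, fun k => if k ≤ N then τ k else T + s, by simp [hτ0], by simp, fun i hi => ?_⟩,
    fun t => if t ≤ T then γ t else η (t - T), ⟨?_, insert T F, hF.insert T, ?_⟩,
    by simp [hT, hγ0], by simp [hs]⟩
  · rcases (Nat.lt_succ_iff.1 hi).lt_or_eq with hi | rfl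
    · obtain ⟨h1, c, hc, hu⟩ := hτ i hi
      have hi' : i + 1 ≤ N := hi
      simp only [hi.le, hi', if_true]
      refine ⟨h1, c, hc, fun t ht => ?_⟩
      rw [if_pos (ht.2.trans_le (hmono _ hi')), hu t ht]
    · simp only [le_refl, if_true, hτN, Nat.not_succ_le_self, if_false]
      exact ⟨by linarith, v, hv, fun t ht => if_neg ht.1.not_gt⟩
  · have h2 : ContinuousOn (fun t => η (t - T)) (Set.Icc T (T + s)) := fun t ht =>
      (ContinuousAt.comp (f := fun t => t - T) (g := η)
        (hη (t - T) ⟨by linarith [ht.1], by linarith [ht.2]⟩).continuousAt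
        (by fun_prop)).continuousWithinAt
    have h3 : Set.Icc 0 (T + s) = Set.Icc 0 T ∪ Set.Icc T (T + s) :=
      (Set.Icc_union_Icc_eq_Icc hT (by linarith)).symm
    rw [h3]
    refine ContinuousOn.union_of_isClosed ?_ ?_ isClosed_Icc isClosed_Icc
    · exact hγc.congr fun t ht => if_pos ht.2
    · refine h2.congr fun t ht => ?_
      rcases ht.1.eq_or_lt with rfl | h4
      · simp [hγT]
      · exact if_neg h4.not_ge
  · rintro t ⟨ht, htF⟩
    rw [Set.mem_insert_iff, not_or] at htF
    change IsInvariantCurveAt ((if t < T then u t else v : p) : GroupLieAlgebra I G) _ t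
    rcases lt_or_gt_of_ne htF.1 with h4 | h4
    · rw [if_pos h4]
      refine IsInvariantCurveAt.congr_of_eventuallyEq (hγ t ⟨⟨ht.1, h4⟩, htF.2⟩) ?_
      filter_upwards [Iio_mem_nhds h4] with r hr using if_pos (le_of_lt hr)
    · rw [if_neg h4.not_gt]
      have h5 : IsInvariantCurveAt ((1 : ℝ) • (v : GroupLieAlgebra I G)) (fun r => η (r - T)) t :=
        IsInvariantCurveAt.comp_hasDerivAt (f := fun r => r - T)
          (hη (t - T) ⟨by linarith, by linarith [ht.2]⟩) ((hasDerivAt_id t).sub_const T)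
      rw [one_smul] at h5
      refine h5.congr_of_eventuallyEq ?_
      filter_upwards [Ioi_mem_nhds h4] with r hr using if_neg (not_le_of_gt hr)

theorem IsReachable.refl {p : Submodule ℝ (GroupLieAlgebra I G)} (D : Set p) (g : G) :
    IsReachable D g g :=
  ⟨0, le_rfl, 0, ⟨0, 0, rfl, rfl, by simp⟩, fun _ => g,
    ⟨continuousOn_const, ∅, Set.finite_empty, by simp⟩, rfl, rfl⟩

/-- The elements by which one can move, forth and back, from every reachable point. -/
def reachableSubgroup {p : Submodule ℝ (GroupLieAlgebra I G)} (D : Set p) : Subgroup G where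
  -- The equivalence, rather than one implication, yields closure under inverses.
  carrier := {h | ∀ g₀ g, IsReachable D g₀ g ↔ IsReachable D g₀ (g * h)}
  one_mem' := by simp
  mul_mem' {a b} ha hb g₀ g := by rw [ha, hb, mul_assoc]
  inv_mem' {a} ha g₀ g := by rw [ha g₀ (g * a⁻¹), inv_mul_cancel_right]

theorem mem_reachableSubgroup_of_curve [LieGroup I ∞ G]
    {p : Submodule ℝ (GroupLieAlgebra I G)} {D : Set p} {v : p} (hv : v ∈ D) (hv' : -v ∈ D)
    {η : ℝ → G} (hη0 : η 0 = 1)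
    (hη : ∀ᶠ t in 𝓝 0, IsInvariantCurveAt (v : GroupLieAlgebra I G) η t) :
    ∀ᶠ t in 𝓝 0, η t ∈ reachableSubgroup D := by
  have move : ∀ (w : p), w ∈ D → -w ∈ D → ∀ (η : ℝ → G), η 0 = 1 → ∀ s > 0,
      (∀ t ∈ Set.Icc 0 s, IsInvariantCurveAt (w : GroupLieAlgebra I G) η t) →
      η s ∈ reachableSubgroup D := by
    intro w hw hw' η hη0 s hs hη g₀ g
    constructor
    · intro h
      refine IsReachable.append hw hs (η := fun t => g * η t) (fun t ht => (hη t ht).mul_left g) ?_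
      simpa [hη0] using h
    · intro h
      -- The way back runs the same curve in reverse, which is an integral curve for `-w`.
      have := IsReachable.append hw' hs (η := fun t => g * η (s - t)) (fun t ht => ?_)
        (g₀ := g₀) (by simpa using h)
      · simpa [hη0] using this
      · have h1 := (hη (s - t) ⟨by linarith [ht.2], by linarith [ht.1]⟩).comp_hasDerivAt
          ((hasDerivAt_id t).const_sub s)
        have h2 := h1.mul_left g
        simpa using h2
  obtain ⟨ε, hε, h⟩ := Metric.eventually_nhds_iff.1 hη
  filter_upwards [Metric.ball_mem_nhds (0 : ℝ) hε] with t ht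
  rw [Metric.mem_ball, Real.dist_0_eq_abs] at ht
  rcases lt_trichotomy t 0 with h0 | rfl | h0
  -- Negative times are positive times of the reversed curve, driven by `-v`.
  · have := move (-v) hv' (by simpa using hv) (fun t => η (-t)) (by simpa using hη0) (-t)
      (by linarith) (fun r hr => ?_)
    · simpa using this
    · have h1 := (h (y := -r) ?_).comp_hasDerivAt (hasDerivAt_neg r)
      · simpa using h1
      · rw [Real.dist_0_eq_abs, abs_neg, abs_of_nonneg hr.1]
        rw [abs_of_neg h0] at ht
        linarith [hr.2]
  · rw [hη0]; exact one_mem _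
  · refine move v hv hv' η hη0 t h0 fun r hr => h ?_
    rw [Real.dist_0_eq_abs, abs_of_nonneg hr.1]
    rw [abs_of_pos h0] at ht
    linarith [hr.2]

end Reachability

/-! ### Generation of the Lie algebra. -/

theorem iteratedBracket_le_of_lie_mem {L : Type*} [LieRing L] [LieAlgebra ℝ L]
    {p V : Submodule ℝ L} (hp : p ≤ V) (h : ∀ v ∈ p, ∀ w ∈ V, ⁅v, w⁆ ∈ V) (k : ℕ) :
    iteratedBracket p k ≤ V := by
  induction k with
  | zero => exact hp
  | succ k ih =>
    refine Submodule.span_le.2 ?_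
    rintro _ ⟨v, hv, w, hw, rfl⟩
    exact h v hv w (ih hw)

/-- Each iterated bracket has its left factor in `p`, so `V` need not be known to be a subalgebra.
-/
theorem GeneratesLieAlgebra.eq_top_of_lie_mem {L : Type*} [LieRing L] [LieAlgebra ℝ L]
    {p V : Submodule ℝ L} (hgen : GeneratesLieAlgebra p) (hp : p ≤ V)
    (h : ∀ v ∈ p, ∀ w ∈ V, ⁅v, w⁆ ∈ V) : V = ⊤ := by
  obtain ⟨m, hm⟩ := hgen
  exact top_le_iff.1 (hm ▸ iSup₂_le fun k _ => iteratedBracket_le_of_lie_mem hp h k)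

/-! ### From generation to controllability. -/

section Controllability

variable {E : Type*} [NormedAddCommGroup E] [NormedSpace ℝ E] [FiniteDimensional ℝ E]
  {H : Type*} [TopologicalSpace H] {I : ModelWithCorners ℝ E H} [I.Boundaryless]
  {G : Type*} [Group G] [TopologicalSpace G] [ChartedSpace H G] [LieGroup I ∞ G]

/-- A subgroup containing short integral curves of a family of left-invariant vector fields which
spans a generating subspace is a neighbourhood of the identity. -/
theorem mem_nhds_one_of_generatesLieAlgebra {p : Submodule ℝ (GroupLieAlgebra I G)}
    (hp : GeneratesLieAlgebra p) {ι : Type*} {b : ι → GroupLieAlgebra I G}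
    (hb : p ≤ Submodule.span ℝ (Set.range b)) {K : Subgroup G}
    (hK : ∀ i, ∃ x : ℝ → E, x 0 = extChartAt I (1 : G) 1 ∧ HasStrictDerivAt x (b i : E) 0 ∧
      ∀ᶠ t in 𝓝 0, (extChartAt I (1 : G)).symm (x t) ∈ K) : (K : Set G) ∈ 𝓝 1 := by
  set S : Set E := {x | (extChartAt I (1 : G)).symm x ∈ K} with hSdef
  have hS : extChartAt I (1 : G) 1 ∈ S := by
    rw [hSdef, Set.mem_ofPred_eq, chart_symm_one]; exact one_mem K
  have hm := hasStrictFDerivAt_chartMul (I := I) (G := G)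
  have hc := (contDiffAt_chartConj (I := I) (G := G)).of_le (m := 2) (by norm_cast)
  have hcx : ∀ᶠ x in 𝓝 (extChartAt I (1 : G) 1), chartConj I G (x, extChartAt I (1 : G) 1) = _ :=
    .of_forall chartConj_left
  have hmS : ∀ᶠ q in 𝓝 (extChartAt I (1 : G) 1, extChartAt I (1 : G) 1),
      q.1 ∈ S → q.2 ∈ S → chartMul I G q ∈ S := by
    filter_upwards [eventually_chart_symm_chartMul] with q hq h1 h2
    rw [hSdef, Set.mem_ofPred_eq, hq]
    exact mul_mem h1 h2
  have hcS : ∀ᶠ q in 𝓝 (extChartAt I (1 : G) 1, extChartAt I (1 : G) 1),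
      q.1 ∈ S → q.2 ∈ S → chartConj I G q ∈ S := by
    filter_upwards [eventually_chart_symm_chartConj] with q hq h1 h2
    rw [hSdef, Set.mem_ofPred_eq, hq]
    exact mul_mem (mul_mem h1 h2) (inv_mem h1)
  let W : Submodule ℝ E := attainableDirections S _ (chartMul I G) hm chartMul_self hmS hS
  have hcurve : ∀ (v : E) (x : ℝ → E), x 0 = extChartAt I (1 : G) 1 → HasStrictDerivAt x v 0 →
      (∀ᶠ t in 𝓝 0, x t ∈ S) → v ∈ W := fun v x hx0 hx hxS =>
    mem_attainableDirections_of_curve hx hx0 hxS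
  have hbracket : ∀ (v w : E) (x : ℝ → E), x 0 = extChartAt I (1 : G) 1 →
      HasStrictDerivAt x v 0 → (∀ᶠ t in 𝓝 0, x t ∈ S) → w ∈ W →
      VectorField.lieBracket ℝ
        (fun x => fderiv ℝ (chartMul I G) (x, extChartAt I (1 : G) 1) (0, v))
        (fun x => fderiv ℝ (chartMul I G) (x, extChartAt I (1 : G) 1) (0, w))
        (extChartAt I (1 : G) 1) ∈ W := fun v w x hx0 hx hxS hw => by
    rw [← fderiv_conj_eq_lieBracket
      ((contDiffAt_chartMul (I := I) (G := G)).of_le (by norm_cast)) hc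
      hm.hasFDerivAt.fderiv fderiv_chartConj hcx eventually_chartMul_chartConj]
    exact fderiv_conj_mem_attainableDirections hc hcx hcS hx.hasDerivAt hx0 hxS hw
  -- `GroupLieAlgebra I G` is `E` by definition; only `V` sees the Lie bracket.
  let V : Submodule ℝ (GroupLieAlgebra I G) := W
  have hbV : ∀ i, b i ∈ V := fun i => by
    obtain ⟨x, hx0, hx, hxS⟩ := hK i
    exact hcurve _ x hx0 hx hxS
  have hpV : p ≤ V := hb.trans (Submodule.span_le.2 (Set.range_subset_iff.2 hbV))
  have hlie : ∀ v ∈ p, ∀ w ∈ V, ⁅v, w⁆ ∈ V := by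
    intro v hv w hw
    -- Only the generators `b i` come with curves in `K`; linearity in the left argument extends the
    -- bracket property to `p`.
    refine Submodule.span_induction (p := fun v _ => ⁅v, w⁆ ∈ V) ?_ ?_ ?_ ?_ (hb hv)
    · rintro _ ⟨i, rfl⟩
      obtain ⟨x, hx0, hx, hxS⟩ := hK i
      rw [groupLieAlgebra_bracket_eq_lieBracket]
      exact hbracket _ _ x hx0 hx hxS hw
    · rw [zero_lie]; exact V.zero_mem
    · intro x y _ _ hx hy
      rw [add_lie]; exact V.add_mem hx hy
    · intro a x _ hx
      rw [smul_lie]; exact V.smul_mem a hx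
  have hV : V = ⊤ := hp.eq_top_of_lie_mem hpV hlie
  have hW : W = ⊤ := hV
  have hSnhds : S ∈ 𝓝 (extChartAt I (1 : G) 1) := mem_nhds_of_attainableDirections_eq_top hW
  filter_upwards [continuousAt_extChartAt (I := I) (1 : G) hSnhds,
    extChartAt_source_mem_nhds (I := I) (1 : G)] with g hg hg'
  have hg : (extChartAt I (1 : G)).symm (extChartAt I (1 : G) g) ∈ K := hg
  rwa [(extChartAt I (1 : G)).left_inv hg'] at hg

theorem isReachable_of_generatesLieAlgebra [ConnectedSpace G]
    {p : Submodule ℝ (GroupLieAlgebra I G)} (hp : GeneratesLieAlgebra p)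
    {D : Set p} (hneg : ∀ v ∈ D, -v ∈ D) (hspan : Submodule.span ℝ D = ⊤) (g₀ g₁ : G) :
    IsReachable D g₀ g₁ := by
  have := topologicalGroup_of_lieGroup I ∞ (G := G)
  have := FiniteDimensional.complete ℝ E
  have hle : p ≤ Submodule.span ℝ (Set.range fun v : D => (v : p).1) := by
    have : (Set.range fun v : D => (v : p).1) = p.subtype '' D := by
      ext; simp
    rw [this, Submodule.span_image, hspan, Submodule.map_top, Submodule.range_subtype]
  have hnhds : (reachableSubgroup D : Set G) ∈ 𝓝 1 := by
    refine mem_nhds_one_of_generatesLieAlgebra hp hle fun v => ?_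
    obtain ⟨x, hx0, hx, hxc⟩ := exists_integralCurve_mulInvariantVectorField (v : p).1
    refine ⟨x, hx0, hx, mem_reachableSubgroup_of_curve v.2 (hneg _ v.2) ?_ hxc⟩
    rw [hx0, chart_symm_one]
  have hopen := (reachableSubgroup D).isOpen_of_mem_nhds hnhds
  have huniv : (reachableSubgroup D : Set G) = Set.univ :=
    IsClopen.eq_univ ⟨(reachableSubgroup D).isClosed_of_isOpen hopen, hopen⟩ ⟨1, one_mem _⟩
  have hmem : g₀⁻¹ * g₁ ∈ (reachableSubgroup D : Set G) := huniv ▸ Set.mem_univ _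
  simpa using (hmem g₀ g₀).1 (.refl D g₀)

end Controllability

theorem theorem1 {n : ℕ} {G : Type*} [Group G] [TopologicalSpace G] [T2Space G]
    [ConnectedSpace G] [ChartedSpace (EuclideanSpace ℝ (Fin n)) G] [LieGroup (𝓡 n) ∞ G]
    (p : Submodule ℝ (GroupLieAlgebra (𝓡 n) G)) (hp : GeneratesLieAlgebra p)
    {r : ℕ} (e : Module.Basis (Fin r) ℝ p) (g₀ g₁ : G) :
    ∃ T : ℝ, 0 ≤ T ∧ ∃ u : ℝ → p,
      IsPiecewiseConstant {v | ∃ j : Fin r, v = e j ∨ v = -e j} T u ∧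
      ∃ γ : ℝ → G, IsControlTrajectory (𝓡 n) (fun t => (u t : GroupLieAlgebra (𝓡 n) G)) T γ ∧
        γ 0 = g₀ ∧ γ T = g₁ := by
  refine isReachable_of_generatesLieAlgebra hp ?_ ?_ g₀ g₁
  · rintro _ ⟨j, rfl | rfl⟩
    · exact ⟨j, .inr rfl⟩
    · exact ⟨j, .inl (neg_neg _)⟩
  · refine top_le_iff.1 (e.span_eq.ge.trans (Submodule.span_mono ?_))
    rintro _ ⟨j, rfl⟩
    exact ⟨j, .inl rfl⟩
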